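/- Let $\mathfrak W$ be an abelian semigroup (written additively, not necessarily with a neutral element). A $\mathfrak W$-weighted graph $(\Gamma,h)$ is a finite graph $\Gamma=(V,E)$, with loops and multiple edges allowed, together with a function $h:V\to\mathfrak W$. For $S\subseteq E$ let $\pi(S)$ be the set of vertex sets of the connected components of $(V,S)$, let $c(S)=|\pi(S)|$, and put $h(B)=\sum_{w\in B}h(w)$ for $B\in\pi(S)$. The contraction $(\Gamma/e,h/e)$ of a link (non-loop edge) $e$ is the usual contraction, the vertex obtained by identifying the endpoints of $e$ receiving the sum of their weights. With independent variables $v$ and $u_k$ ($k\in\mathfrak W$), define $$Q_{(\Gamma,h)}(\mathbf u,v)=\sum_{S\subseteq E}v^{|S|-|V|+c(S)}\prod_{B\in\pi(S)}u_{h(B)}\in\mathbb Z[\mathbf u,v].$$ For a commutative ring $R$, a family $x=(x_k)_{k\in\mathfrak W}$ in $R$ and $y\in R$, consider the following properties of an $R$-valued function $f$ of $\mathfrak W$-weighted graphs: (a) $f(\Gamma,h)=f(\Gamma\setminus e,h)+f(\Gamma/e,h/e)$ for every link $e$; (b) $f(\Gamma,h)=f(\Gamma',h')$ if $(\Gamma,h)$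 and $(\Gamma',h')$ are isomorphic (as weighted graphs); (c) $f(\emptyset)=1$; (d) $f((V,\emptyset),h)=\prod_{w\in V}x_{h(w)}$; (e) $f(\Gamma,h)=(y+1)\,f(\Gamma\setminus e,h)$ for every loop $e$. Then: (1) $(\Gamma,h)\mapsto Q_{(\Gamma,h)}(\mathbf u,v)$ has the properties (a)–(e), with $R=\mathbb Z[\mathbf u,v]$, $x_k=u_k$, $y=v$. (2) It is universal with these properties: for every commutative ring $R$, all $x$ and $y$ as above, and every $R$-valued function $f$ of $\mathfrak W$-weighted graphs, $f$ has the properties (a)–(e) if and only if $f(\Gamma,h)=Q_{(\Gamma,h)}(\mathbf u,v)\big|_{u_k=x_k,\,v=y}$ for all $(\Gamma,h)$. (3) $Q$ is multiplicative: $Q_{(\Gamma,h)}$ is the product of the polynomials $Q$ of the connected components of $(\Gamma,h)$ (with the restricted weights). (4) $Q$ has a spanning-tree expansion: for every weighted graph $(\Gamma,h)$ and every linear ordering of $E$, $$Q_{(\Gamma,h)}(\mathbf u,v)=\sum_T(v+1)^{\epsilon(T)}\sum_{\mathrm{II}(T)\subseteq F\subseteq T}\ \prod_{B\in\pi(F)}u_{h(B)},$$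 where $T$ ranges over the maximal spanning forests of $\Gamma$ (the spanning trees, if $\Gamma$ is connected). Here $\epsilon(T)$ is the number of edges $e\notin T$ that are the largest edge of the unique circle in $T\cup\{e\}$, and $\mathrm{II}(T)$ is the set of edges $e\in T$ that are not the largest edge of $\operatorname{clos}(T)\setminus\operatorname{clos}(T\setminus e)$, where $\operatorname{clos}(S)$ consists of $S$ and all edges $e$ that lie in a circle contained in $S\cup\{e\}$ (a loop being a circle of length 1, and a pair of parallel links one of length 2). -/

import Mathlib

universe u w r

/-- The sum of a nonempty finite family in a commutative semigroup `W`, which need not have a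
neutral element: it is computed after adjoining one, see `coe_semigroupSum`. -/
noncomputable def semigroupSum {W : Type w} [AddCommSemigroup W] {ι : Type u}
    (s : Finset ι) (hs : s.Nonempty) (h : ι → W) : W :=
  WithZero.unzero (x := ∑ i ∈ s, (h i : WithZero W)) (by
    induction hs using Finset.Nonempty.cons_induction with
    | singleton a => simp
    | cons a s ha hs ih =>
      obtain ⟨k, hk⟩ := WithZero.ne_zero_iff_exists.1 ih
      rw [Finset.sum_cons, ← hk, ← WithZero.coe_add]
      exact WithZero.coe_ne_zero)

theorem coe_semigroupSum {W : Type w} [AddCommSemigroup W] {ι : Type u}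
    (s : Finset ι) (hs : s.Nonempty) (h : ι → W) :
    ((semigroupSum s hs h : W) : WithZero W) = ∑ i ∈ s, (h i : WithZero W) :=
  WithZero.coe_unzero _

/-- A finite graph, with loops and multiple edges permitted (and no half or loose edges), whose
vertices carry weights in `W`. -/
structure WeightedGraph (W : Type w) where
  /-- the vertices -/
  V : Type u
  /-- the edges -/
  E : Type u
  finV : Finite V
  finE : Finite E
  /-- the unordered pair of endpoints of an edge; the two coincide when the edge is a loop -/
  ends : E → Sym2 V
  /-- the vertex weights -/
  h : V → W

namespace WeightedGraph

noncomputable instance instFintypeV {W : Type w} (G : WeightedGraph.{u} W) : Fintype G.V :=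
  haveI := G.finV
  Fintype.ofFinite _

noncomputable instance instFintypeE {W : Type w} (G : WeightedGraph.{u} W) : Fintype G.E :=
  haveI := G.finE
  Fintype.ofFinite _

/-- An edge is a loop if its endpoints coincide. -/
def IsLoop {W : Type w} (G : WeightedGraph.{u} W) (e : G.E) : Prop := (G.ends e).IsDiag

/-- An edge is a link if its endpoints are distinct. -/
def IsLink {W : Type w} (G : WeightedGraph.{u} W) (e : G.E) : Prop := ¬ (G.ends e).IsDiag

/-- The adjacency of distinct vertices in the spanning subgraph `(V, S)`. -/
def spanning {W : Type w} (G : WeightedGraph.{u} W) (S : Set G.E) : SimpleGraph G.V :=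
  SimpleGraph.fromRel (fun a b => ∃ e ∈ S, G.ends e = s(a, b))

/-- `π(S)`, the partition of the vertex set into connected components of `(V, S)`; a component is
identified with its vertex set. -/
abbrev Part {W : Type w} (G : WeightedGraph.{u} W) (S : Set G.E) : Type u :=
  (G.spanning S).ConnectedComponent

/-- The class in `π(S)` of a vertex. -/
abbrev part {W : Type w} (G : WeightedGraph.{u} W) (S : Set G.E) (a : G.V) : G.Part S :=
  (G.spanning S).connectedComponentMk a

instance instFinitePart {W : Type w} (G : WeightedGraph.{u} W) (S : Set G.E) :
    Finite (G.Part S) :=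
  Finite.of_surjective (G.part S) Quot.mk_surjective

noncomputable instance instFintypePart {W : Type w} (G : WeightedGraph.{u} W) (S : Set G.E) :
    Fintype (G.Part S) := Fintype.ofFinite _

open Classical in
/-- The set of vertices in a class of `π(S)`. -/
noncomputable def block {W : Type w} (G : WeightedGraph.{u} W) (S : Set G.E) (B : G.Part S) :
    Finset G.V :=
  Finset.univ.filter (fun a => G.part S a = B)

open Classical in
theorem block_nonempty {W : Type w} (G : WeightedGraph.{u} W) (S : Set G.E) (B : G.Part S) :
    (G.block S B).Nonempty := by
  obtain ⟨a, ha⟩ := Quot.mk_surjective B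
  exact ⟨a, Finset.mem_filter.2 ⟨Finset.mem_univ a, ha⟩⟩

/-- `h(B)`, the semigroup sum of the weights of the vertices in a class `B` of `π(S)`. -/
noncomputable def blockWeight {W : Type w} [AddCommSemigroup W] (G : WeightedGraph.{u} W)
    (S : Set G.E) (B : G.Part S) : W :=
  semigroupSum (G.block S B) (G.block_nonempty S B) G.h

/-- Deletion of an edge set. -/
def delete {W : Type w} (G : WeightedGraph.{u} W) (S : Set G.E) : WeightedGraph.{u} W where
  V := G.V
  E := {e : G.E // e ∉ S}
  finV := G.finV
  finE := haveI := G.finE; inferInstance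
  ends e := G.ends e
  h := G.h

/-- Contraction of an edge set `S`: each class of `π(S)` is identified to a single vertex, whose
weight is the sum of the weights in the class, and `S` is deleted. -/
noncomputable def contract {W : Type w} [AddCommSemigroup W] (G : WeightedGraph.{u} W)
    (S : Set G.E) : WeightedGraph.{u} W where
  V := G.Part S
  E := {e : G.E // e ∉ S}
  finV := inferInstance
  finE := haveI := G.finE; inferInstance
  ends e := (G.ends e).map (G.part S)
  h := G.blockWeight S

/-- The connected component of `G` with vertex set `B`: the subgraph induced by `B`, with the
restricted weights. -/
def component {W : Type w} (G : WeightedGraph.{u} W) (B : G.Part Set.univ) :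
    WeightedGraph.{u} W where
  V := {a : G.V // G.part Set.univ a = B}
  E := {e : G.E // ∀ a ∈ G.ends e, G.part Set.univ a = B}
  finV := haveI := G.finV; inferInstance
  finE := haveI := G.finE; inferInstance
  ends e := (G.ends e).attachWith e.2
  h a := G.h a

/-- Isomorphism of weighted graphs. -/
structure Iso {W : Type w} (G H : WeightedGraph.{u} W) where
  vert : G.V ≃ H.V
  edge : G.E ≃ H.E
  ends_edge : ∀ e, H.ends (edge e) = (G.ends e).map vert
  h_vert : ∀ a, H.h (vert a) = G.h a

/-! ### The dichromatic polynomial -/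

/-- The polynomial ring `ℤ[𝐮, v]` with one variable `u_k` for each weight `k` (the variable
`some k`) and one more variable `v` (the variable `none`). -/
abbrev DPoly (W : Type w) : Type w := MvPolynomial (Option W) ℤ

/-- The variable `u_k`. -/
noncomputable def uVar {W : Type w} (k : W) : DPoly W := MvPolynomial.X (some k)

/-- The variable `v`. -/
noncomputable def vVar {W : Type w} : DPoly W := MvPolynomial.X none

/-- The substitution `u_k ↦ x k`, `v ↦ y`. -/
noncomputable def subst {W : Type w} {R : Type r} [CommRing R] (x : W → R) (y : R) :
    DPoly W →+* R :=
  (MvPolynomial.aeval (fun o : Option W => o.elim y x)).toRingHom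

/-- The weighted-graph dichromatic polynomial
`∑_{S ⊆ E} v ^ (|S| - n + c(S)) ∏_{B ∈ π(S)} u_{h(B)}`.  The exponent is never negative, so that
the natural-number subtraction in it is a true one. -/
noncomputable def dichromatic {W : Type w} [AddCommSemigroup W] (G : WeightedGraph.{u} W) :
    DPoly W :=
  ∑ S : Finset G.E,
    vVar ^ (S.card + Fintype.card (G.Part (S : Set G.E)) - Fintype.card G.V) *
      ∏ B : G.Part (S : Set G.E), uVar (G.blockWeight (S : Set G.E) B)

/-- The defining properties, for a function `f` on weighted graphs with values in a commutative
ring, where `x k` and `y` are the values in the ring that play the roles of `u_k` and `v`. -/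
structure TutteConditions {W : Type w} [AddCommSemigroup W] {R : Type r} [CommRing R]
    (f : WeightedGraph.{u} W → R) (x : W → R) (y : R) : Prop where
  /-- deletion-contraction of links -/
  additivity : ∀ (G : WeightedGraph.{u} W) (e : G.E), G.IsLink e →
    f G = f (G.delete {e}) + f (G.contract {e})
  /-- isomorphism invariance -/
  invariance : ∀ G H : WeightedGraph.{u} W, Nonempty (Iso G H) → f G = f H
  /-- the value on the empty graph -/
  unitarity : ∀ G : WeightedGraph.{u} W, IsEmpty G.V → f G = 1
  /-- the value on a graph without edges -/
  initial : ∀ G : WeightedGraph.{u} W, IsEmpty G.E → f G = ∏ a : G.V, x (G.h a)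
  /-- deletion of loops -/
  loop : ∀ (G : WeightedGraph.{u} W) (e : G.E), G.IsLoop e → f G = (y + 1) * f (G.delete {e})

/-! ### Spanning trees and activities -/

/-- A circle, as an edge set: the edges `e₀, …, eₙ` of a closed walk
`a₀ e₀ a₁ e₁ ⋯ aₙ eₙ a₀` without repeated vertices or edges.  A loop is a circle, and so is a pair
of parallel links.  The addition is cyclic. -/
def IsCircle {W : Type w} (G : WeightedGraph.{u} W) (C : Set G.E) : Prop :=
  ∃ (n : ℕ) (a : Fin (n + 1) → G.V) (e : Fin (n + 1) → G.E),
    Function.Injective a ∧ Function.Injective e ∧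
    (∀ i, G.ends (e i) = s(a i, a (i + 1))) ∧ C = Set.range e

/-- A spanning forest, as an edge set. -/
def IsForest {W : Type w} (G : WeightedGraph.{u} W) (F : Set G.E) : Prop :=
  ∀ C ⊆ F, ¬ G.IsCircle C

/-- A maximal spanning forest, as an edge set: one spanning tree in each component of the graph.
If the graph is connected, this is a spanning tree. -/
def IsSpanningTree {W : Type w} (G : WeightedGraph.{u} W) (T : Set G.E) : Prop :=
  Maximal G.IsForest T

/-- The closure of an edge set. -/
def clos {W : Type w} (G : WeightedGraph.{u} W) (S : Set G.E) : Set G.E :=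
  S ∪ {e | ∃ C, G.IsCircle C ∧ e ∈ C ∧ C ⊆ insert e S}

/-- The externally active edges with respect to `T`: those outside of `T` that are largest in the
circle which they form with edges of `T`. -/
def extActive {W : Type w} (G : WeightedGraph.{u} W) [LinearOrder G.E] (T : Set G.E) : Set G.E :=
  {e | e ∉ T ∧ ∃ C, G.IsCircle C ∧ C ⊆ insert e T ∧ IsGreatest C e}

/-- The internally active edges with respect to `T`: those edges `e` of `T` that are largest in
the fundamental cocircuit `clos T \ clos (T \ e)`. -/
def intActive {W : Type w} (G : WeightedGraph.{u} W) [LinearOrder G.E] (T : Set G.E) : Set G.E :=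
  {e | e ∈ T ∧ IsGreatest (G.clos T \ G.clos (T \ {e})) e}

/-- The internally inactive edges with respect to `T`. -/
def intInactive {W : Type w} (G : WeightedGraph.{u} W) [LinearOrder G.E] (T : Set G.E) :
    Set G.E :=
  T \ G.intActive T

open Classical in
/-- The spanning-tree expansion
`∑_T (v + 1) ^ ε(T) ∑_{II(T) ⊆ F ⊆ T} ∏_{B ∈ π(F)} u_{h(B)}` with respect to a linear ordering of
the edges. -/
noncomputable def treeExpansion {W : Type w} [AddCommSemigroup W] (G : WeightedGraph.{u} W)
    [LinearOrder G.E] : DPoly W :=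
  ∑ T ∈ Finset.univ.filter (fun T : Finset G.E => G.IsSpanningTree (T : Set G.E)),
    (vVar + 1) ^ (G.extActive (T : Set G.E)).ncard *
      ∑ F ∈ T.powerset.filter (fun F : Finset G.E => G.intInactive (T : Set G.E) ⊆ F),
        ∏ B : G.Part (F : Set G.E), uVar (G.blockWeight (F : Set G.E) B)

end WeightedGraph

/-!
Isomorphisms, deletions and contractions all present a graph `H` as a minor of a graph `G` in which
the components of an edge set `X` are identified; when `X` is a forest, the term of `S ⊆ E(H)` in
the subset expansion of `H` equals the term of `X ∪ S` in that of `G`. So the subsets without and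
with a link `e` sum up to deletion and contraction of `e`, while adding a loop to a subset
multiplies its term by `v`. Uniqueness follows by induction on the number of edges, and
multiplicativity by taking traces on the components.

For the tree expansion, each edge set `S` lies in the interval `[B \ IA(B), B ∪ EA(B)]` of exactly
one basis `B` of the graphic matroid (Crapo): `B ∩ S` has to be the greedy basis of `S`, and the
complement of `B ∪ S` that of the complement of `S` in the dual matroid. Externally active edges
are spanned by the internally inactive ones, so that adding them to a forest in the interval only
contributes a power of `v`, and their `2 ^ ε` subsets together the factor `(v + 1) ^ ε`.
-/

section MatroidActivity

open scoped Matroid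

variable {α : Type*} {M : Matroid α} {B I J S X : Set α} {e : α}

theorem mem_dual_closure_iff_notMem_closure_sdiff (he : e ∈ M.E \ X) :
    e ∈ M✶.closure X ↔ e ∉ M.closure ((M.E \ X) \ {e}) := by
  have hcoloop := Matroid.delete_isColoop_iff (e := e) M X
  rwa [and_iff_left (show e ∈ M.E ∧ e ∉ X from he), ← Matroid.dual_isLoop_iff_isColoop,
    Matroid.dual_delete, Matroid.contract_isLoop_iff_mem_closure, and_iff_left he.2] at hcoloop

theorem isBase_union_sdiff_of_isBasis_dual (hS : S ⊆ M.E) (hI : M.IsBasis I S)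
    (hJ : M✶.IsBasis J (M.E \ S)) : M.IsBase ((M.E \ S) \ J ∪ I) := by
  have hcontract : (M ／ S).IsBase ((M.E \ S) \ J) := by
    rw [← Matroid.dual_delete_dual]
    exact (Matroid.delete_isBase_iff.2 hJ).compl_isBase_dual
  have hspanning := (Matroid.contract_spanning_iff'.1 hcontract.spanning).1
  rw [Set.inter_eq_left.2 hS] at hspanning
  refine Matroid.isBase_iff_indep_closure_eq.2 ⟨(hI.contract_indep_iff.1 hcontract.indep).1, ?_⟩
  rw [Matroid.closure_union_congr_right hI.closure_eq_closure, hspanning.closure_eq]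

variable [LinearOrder α]

/-- The elements outside of `B` that are spanned by smaller elements of `B`. -/
def externallyActive (M : Matroid α) (B : Set α) : Set α :=
  {e ∈ M.E \ B | e ∈ M.closure {f ∈ B | f < e}}

/-- The internally active elements of `B`, defined by duality. -/
def internallyActive (M : Matroid α) (B : Set α) : Set α :=
  externallyActive M✶ (M.E \ B)

/-- The interval of sets between `B` without its internally active elements and `B` with its
externally active elements. -/
def activityInterval (M : Matroid α) (B : Set α) : Set (Set α) :=
  Set.Icc (B \ internallyActive M B) (B ∪ externallyActive M B)

/-- The lexicographically first basis of `S`, chosen greedily. -/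
def greedyBasis (M : Matroid α) (S : Set α) : Set α :=
  {e ∈ S | e ∉ M.closure {f ∈ S | f < e}}

theorem internallyActive_dual (hB : B ⊆ M.E) :
    internallyActive M✶ (M.E \ B) = externallyActive M B := by
  rw [internallyActive, Matroid.dual_dual, Matroid.dual_ground, Set.sdiff_sdiff_cancel_left hB]

theorem compl_mem_activityInterval_dual_iff (hB : B ⊆ M.E) (hS : S ⊆ M.E) :
    M.E \ S ∈ activityInterval M✶ (M.E \ B) ↔ S ∈ activityInterval M B := by
  have hactive : externallyActive M✶ (M.E \ B) = internallyActive M B := rfl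
  rw [activityInterval, activityInterval, internallyActive_dual hB, hactive, Set.mem_Icc,
    Set.mem_Icc, and_comm]
  refine and_congr ⟨fun h e he => ?_, fun h e he => ?_⟩ ⟨fun h e he => ?_, fun h e he => ?_⟩
  · by_contra heS
    rcases h ⟨hB he.1, heS⟩ with heB | heI
    exacts [heB.2 he.1, he.2 heI]
  · by_cases heB : e ∈ B
    · exact Or.inr (by_contra fun heI => he.2 (h ⟨heB, heI⟩))
    · exact Or.inl ⟨he.1, heB⟩
  · by_contra heBA
    exact (h ⟨⟨hS he, fun heB => heBA (Or.inl heB)⟩, fun heA => heBA (Or.inr heA)⟩).2 he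
  · exact ⟨he.1.1, fun heS => (h heS).elim he.1.2 he.2⟩

theorem greedyBasis_subset : greedyBasis M S ⊆ S := Set.sep_subset _ _

theorem greedyBasis_sep_lt :
    greedyBasis M {f ∈ S | f < e} = {f ∈ greedyBasis M S | f < e} := by
  ext f
  have hsep (hfe : f < e) : {g ∈ {f ∈ S | f < e} | g < f} = {g ∈ S | g < f} := by
    ext g
    exact ⟨fun hg => ⟨hg.1.1, hg.2⟩, fun hg => ⟨⟨hg.1, hg.2.trans hfe⟩, hg.2⟩⟩
  constructor
  · rintro ⟨⟨hfS, hfe⟩, hf⟩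
    exact ⟨⟨hfS, hsep hfe ▸ hf⟩, hfe⟩
  · rintro ⟨⟨hfS, hf⟩, hfe⟩
    exact ⟨⟨hfS, hfe⟩, (hsep hfe).symm ▸ hf⟩

theorem indep_greedyBasis [M.Finitary] (hS : S ⊆ M.E) : M.Indep (greedyBasis M S) := by
  rw [Matroid.indep_iff_forall_subset_not_isCircuit (greedyBasis_subset.trans hS)]
  intro C hCS hC
  obtain ⟨e, heC, hemax⟩ := Set.exists_max_image C id hC.finite hC.nonempty
  refine (hCS heC).2 (M.closure_subset_closure ?_ (hC.mem_closure_sdiff_singleton_of_mem heC))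
  exact fun f hf => ⟨(hCS hf.1).1, lt_of_le_of_ne (hemax f hf.1) hf.2⟩

theorem isBasis_greedyBasis [M.Finite] (hS : S ⊆ M.E) : M.IsBasis (greedyBasis M S) S := by
  refine Matroid.isBasis_iff_indep_closure.2 ⟨indep_greedyBasis hS, ?_, greedyBasis_subset⟩
  by_contra hspan
  have hfinite : (S \ M.closure (greedyBasis M S)).Finite :=
    M.ground_finite.subset (Set.sdiff_subset.trans hS)
  obtain ⟨e, he, hemin⟩ := Set.exists_min_image _ id hfinite (Set.nonempty_of_not_subset hspan)
  have hbelow : {f ∈ S | f < e} ⊆ M.closure (greedyBasis M S) := fun f hf =>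
    not_not.1 fun hfcl => (hemin f ⟨hf.1, hfcl⟩).not_gt hf.2
  refine he.2 (M.mem_closure_of_mem' ⟨he.1, fun hecl => he.2 ?_⟩ (hS he.1))
  exact M.closure_subset_closure_of_subset_closure hbelow hecl

theorem mem_closure_greedyBasis_lt [M.Finite] (hS : S ⊆ M.E) (he : e ∈ S \ greedyBasis M S) :
    e ∈ M.closure {f ∈ greedyBasis M S | f < e} := by
  rw [← greedyBasis_sep_lt,
    (isBasis_greedyBasis ((Set.sep_subset _ _).trans hS)).closure_eq_closure]
  by_contra hecl
  exact he.2 ⟨he.1, hecl⟩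

theorem greedyBasis_eq_of_indep [M.Finite] (hS : S ⊆ M.E) (hI : M.Indep I) (hIS : I ⊆ S)
    (hlt : ∀ e ∈ S \ I, e ∈ M.closure {f ∈ I | f < e}) : greedyBasis M S = I := by
  refine (isBasis_greedyBasis hS).eq_of_subset_indep hI (fun e he => ?_) hIS
  by_contra heI
  refine he.2 (M.closure_subset_closure ?_ (hlt e ⟨he.1, heI⟩))
  exact fun f hf => ⟨hIS hf.1, hf.2⟩

-- An internally active element in the circuit would meet it in a single element of a cocircuit.
theorem mem_closure_sdiff_internallyActive (he : e ∈ externallyActive M B) :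
    e ∈ M.closure {f ∈ B \ internallyActive M B | f < e} := by
  obtain ⟨⟨-, heB⟩, hecl⟩ := he
  obtain ⟨C, hCB, hC, heC⟩ := Matroid.exists_isCircuit_of_mem_closure hecl fun h => heB h.1
  refine M.closure_subset_closure (fun f hf => ?_) (hC.mem_closure_sdiff_singleton_of_mem heC)
  obtain ⟨hfB, hfe⟩ := (hCB hf.1).resolve_left hf.2
  refine ⟨⟨hfB, fun hfI => ?_⟩, hfe⟩
  have hfground : f ∈ M.E := hC.subset_ground hf.1
  refine (mem_dual_closure_iff_notMem_closure_sdiff ⟨hfground, fun h => lt_irrefl f h.2⟩).1 hfI.2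
    (M.closure_subset_closure ?_ (hC.mem_closure_sdiff_singleton_of_mem hf.1))
  refine fun g hg => ⟨⟨hC.subset_ground hg.1, fun hgB => ?_⟩, hg.2⟩
  rcases hCB hg.1 with rfl | hgB'
  exacts [hgB.2.not_gt hfe, hgB.1.2 hgB'.1]

theorem greedyBasis_eq_inter_of_mem_activityInterval [M.Finite] (hB : M.IsBase B) (hS : S ⊆ M.E)
    (h : S ∈ activityInterval M B) : greedyBasis M S = B ∩ S := by
  refine greedyBasis_eq_of_indep hS (hB.indep.inter_right S) Set.inter_subset_right ?_
  rintro e ⟨heS, heB⟩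
  have heA : e ∈ externallyActive M B := (h.2 heS).resolve_left fun heB' => heB ⟨heB', heS⟩
  refine M.closure_subset_closure ?_ (mem_closure_sdiff_internallyActive heA)
  exact fun f hf => ⟨⟨hf.1.1, h.1 hf.1⟩, hf.2⟩

theorem subset_union_externallyActive [M.Finite] (hS : S ⊆ M.E) (h : greedyBasis M S = B ∩ S) :
    S ⊆ B ∪ externallyActive M B := by
  intro e heS
  by_cases heB : e ∈ B
  · exact Or.inl heB
  · have hecl := mem_closure_greedyBasis_lt hS ⟨heS, fun he => heB (h ▸ he).1⟩
    rw [h] at hecl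
    refine Or.inr ⟨⟨hS heS, heB⟩, M.closure_subset_closure ?_ hecl⟩
    exact fun f hf => ⟨hf.1.1, hf.2⟩

theorem mem_activityInterval_iff [M.Finite] (hB : M.IsBase B) (hS : S ⊆ M.E) :
    S ∈ activityInterval M B ↔
      greedyBasis M S = B ∩ S ∧ greedyBasis M✶ (M.E \ S) = (M.E \ B) ∩ (M.E \ S) := by
  have hdual := compl_mem_activityInterval_dual_iff hB.subset_ground hS
  constructor
  · intro h
    exact ⟨greedyBasis_eq_inter_of_mem_activityInterval hB hS h,
      greedyBasis_eq_inter_of_mem_activityInterval hB.compl_isBase_dual Set.sdiff_subset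
        (hdual.2 h)⟩
  · rintro ⟨h, h'⟩
    have hsubset := subset_union_externallyActive hS h
    have hsubset' := subset_union_externallyActive (M := M✶) Set.sdiff_subset h'
    refine ⟨fun e he => by_contra fun heS => ?_, hsubset⟩
    exact (hsubset' ⟨hB.subset_ground he.1, heS⟩).elim (fun heB => heB.2 he.1) he.2

theorem existsUnique_isBase_mem_activityInterval [M.Finite] (hS : S ⊆ M.E) :
    ∃! B, M.IsBase B ∧ S ∈ activityInterval M B := by
  have hI : greedyBasis M S ⊆ S := greedyBasis_subset
  have hJ : greedyBasis M✶ (M.E \ S) ⊆ M.E \ S := greedyBasis_subset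
  have hbase := isBase_union_sdiff_of_isBasis_dual hS (isBasis_greedyBasis hS)
    (isBasis_greedyBasis (M := M✶) Set.sdiff_subset)
  refine ⟨_, ⟨hbase, (mem_activityInterval_iff hbase hS).2 ⟨?_, ?_⟩⟩, ?_⟩
  · grind
  · grind
  · rintro B ⟨hB, hBS⟩
    obtain ⟨h, h'⟩ := (mem_activityInterval_iff hB hS).1 hBS
    have := hB.subset_ground
    rw [h, h']
    grind

theorem mem_internallyActive_iff (hB : M.IsBase B) :
    e ∈ internallyActive M B ↔ e ∈ B ∧ IsGreatest (M.E \ M.closure (B \ {e})) e := by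
  rw [internallyActive, externallyActive, Set.mem_ofPred_eq, Matroid.dual_ground,
    Set.sdiff_sdiff_cancel_left hB.subset_ground]
  refine and_congr_right fun heB => ?_
  have heE := hB.subset_ground heB
  rw [mem_dual_closure_iff_notMem_closure_sdiff ⟨heE, fun h => lt_irrefl e h.2⟩]
  have hsub : B \ {e} ⊆ (M.E \ {f ∈ M.E \ B | f < e}) \ {e} := fun f hf =>
    ⟨⟨hB.subset_ground hf.1, fun h => h.1.2 hf.1⟩, hf.2⟩
  constructor
  · refine fun hecl => ⟨⟨heE, hB.indep.notMem_closure_sdiff_of_mem heB⟩, fun f hf => ?_⟩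
    by_contra! hef
    have hfB : f ∈ M.closure (insert e (B \ {e})) := by
      rw [Set.insert_sdiff_self_of_mem heB, hB.closure_eq]
      exact hf.1
    refine hecl (M.closure_subset_closure (Set.insert_subset ?_ hsub)
      (M.mem_closure_insert hf.2 hfB))
    exact ⟨⟨hf.1, fun h => h.2.not_gt hef⟩, hef.ne'⟩
  · refine fun hgreatest hecl => hgreatest.1.2 ?_
    refine M.closure_subset_closure_of_subset_closure (fun f hf => ?_) hecl
    by_contra hfcl
    have hfe := lt_of_le_of_ne (hgreatest.2 ⟨hf.1.1, hfcl⟩) hf.2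
    exact hfcl (M.mem_closure_of_mem' ⟨by_contra fun hfB => hf.1.2 ⟨⟨hf.1.1, hfB⟩, hfe⟩, hf.2⟩
      hf.1.1)

end MatroidActivity

theorem apply_eq_apply_add_one_of_forall_ne {β : Type*} {n : ℕ} {c : Fin (n + 1) → β}
    {j : Fin (n + 1)} (h : ∀ i ≠ j, c i = c (i + 1)) : c j = c (j + 1) := by
  have hconst : ∀ i, c (j + 1 + i) = c (j + 1) := by
    refine Fin.induction (by rw [add_zero]) fun i ih => ?_
    have hne : j + 1 + i.castSucc ≠ j := by
      rw [add_assoc, add_comm 1, Fin.coeSucc_eq_succ, Ne, add_eq_left]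
      exact Fin.succ_ne_zero i
    rw [← ih, h _ hne, add_assoc (j + 1), Fin.coeSucc_eq_succ]
  have hlast := hconst (Fin.last n)
  rwa [add_assoc, add_comm 1, Fin.last_add_one, add_zero] at hlast

theorem exists_equiv_of_surjective {V A B : Type*} {p : V → A} {q : V → B}
    (hp : Function.Surjective p) (hq : Function.Surjective q)
    (hpq : ∀ a b, p a = p b ↔ q a = q b) : ∃ φ : A ≃ B, ∀ a, φ (p a) = q a := by
  have hsection (a : V) : q (Function.surjInv hp (p a)) = q a :=
    (hpq _ a).1 (Function.surjInv_eq hp (p a))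
  refine ⟨Equiv.ofBijective (q ∘ Function.surjInv hp) ⟨fun x y hxy => ?_, fun z => ?_⟩, hsection⟩
  · have hp_eq := (hpq _ _).2 hxy
    rwa [Function.surjInv_eq hp, Function.surjInv_eq hp] at hp_eq
  · obtain ⟨a, rfl⟩ := hq z
    exact ⟨p a, hsection a⟩

theorem sum_finset_eq_sum_map_add_sum_insert {E F M : Type*} [Fintype E] [Fintype F]
    [DecidableEq E] [AddCommMonoid M] {e : E} {ι : F ↪ E} (hι : Set.range ι = {e}ᶜ)
    (g : Finset E → M) :
    ∑ S, g S = ∑ S : Finset F, g (S.map ι) + ∑ S : Finset F, g (insert e (S.map ι)) := by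
  have hmap : Finset.univ.map ι = Finset.univ.erase e := by
    apply Finset.coe_injective
    simp [hι, Set.compl_eq_univ_sdiff]
  have hpowerset : (Finset.univ.erase e).powerset =
      Finset.univ.map ⟨Finset.map ι, Finset.map_injective ι⟩ := by
    ext S
    simp [← hmap, Finset.subset_map_iff, eq_comm]
  have hinsert := Finset.sum_powerset_insert (Finset.notMem_erase e Finset.univ) g
  simpa only [Finset.insert_erase (Finset.mem_univ e), Finset.powerset_univ, hpowerset,
    Finset.sum_map, Function.Embedding.coeFn_mk] using hinsert

namespace WeightedGraph

variable {W : Type w} {G : WeightedGraph.{u} W}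

section Closure

variable {S S' C : Set G.E} {e f : G.E} {a b : G.V}

theorem exists_ends (e : G.E) : ∃ a b, G.ends e = s(a, b) := by
  induction h : G.ends e with | _ a b => exact ⟨a, b, rfl⟩

theorem part_surjective (S : Set G.E) : Function.Surjective (G.part S) := Quot.mk_surjective

theorem isDiag_map_part_of_mem (he : e ∈ S) : ((G.ends e).map (G.part S)).IsDiag := by
  obtain ⟨a, b, hab⟩ := exists_ends e
  rw [hab, Sym2.map_mk, Sym2.mk_isDiag_iff]
  by_cases h : a = b
  · rw [h]
  · exact SimpleGraph.ConnectedComponent.sound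
      (SimpleGraph.Adj.reachable ⟨h, Or.inl ⟨e, he, hab⟩⟩)

theorem eq_of_part_eq {α : Type*} (f : G.V → α)
    (hf : ∀ e ∈ S, ((G.ends e).map f).IsDiag) (h : G.part S a = G.part S b) : f a = f b := by
  obtain ⟨p⟩ := SimpleGraph.ConnectedComponent.exact h
  induction p with
  | nil => rfl
  | cons hadj p ih =>
    rw [← ih (SimpleGraph.ConnectedComponent.sound p.reachable)]
    obtain ⟨-, ⟨e, he, h⟩ | ⟨e, he, h⟩⟩ := hadj
    · simpa only [h, Sym2.map_mk, Sym2.mk_isDiag_iff] using hf e he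
    · simpa only [h, Sym2.map_mk, Sym2.mk_isDiag_iff, eq_comm] using hf e he

theorem part_mono (hS : S' ⊆ S) (h : G.part S' a = G.part S' b) : G.part S a = G.part S b :=
  eq_of_part_eq (G.part S) (fun _ he => isDiag_map_part_of_mem (hS he)) h

theorem IsCircle.nonempty (hC : G.IsCircle C) : C.Nonempty := by
  obtain ⟨n, a, e, -, -, -, rfl⟩ := hC
  exact Set.range_nonempty e

theorem IsCircle.isDiag_map_part_sdiff (hC : G.IsCircle C) (hf : f ∈ C) :
    ((G.ends f).map (G.part (C \ {f}))).IsDiag := by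
  obtain ⟨n, a, e, -, he, hends, rfl⟩ := hC
  obtain ⟨j, rfl⟩ := hf
  rw [hends j, Sym2.map_mk, Sym2.mk_isDiag_iff]
  refine apply_eq_apply_add_one_of_forall_ne
    (c := fun i => G.part (Set.range e \ {e j}) (a i)) fun i hij => ?_
  have hi : e i ∈ Set.range e \ {e j} := ⟨⟨i, rfl⟩, fun h => hij (he h)⟩
  simpa only [hends i, Sym2.map_mk, Sym2.mk_isDiag_iff] using isDiag_map_part_of_mem hi

theorem exists_path_of_part_eq (h : G.part S a = G.part S b) :
    ∃ (n : ℕ) (v : Fin (n + 1) → G.V) (g : Fin n → G.E), Function.Injective v ∧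
      (∀ i, g i ∈ S ∧ G.ends (g i) = s(v i.castSucc, v i.succ)) ∧
      v 0 = a ∧ v (Fin.last n) = b := by
  obtain ⟨p, hp⟩ := (SimpleGraph.ConnectedComponent.exact h).exists_isPath
  have hadj (i : Fin p.length) :
      ∃ e ∈ S, G.ends e = s(p.getVert i.castSucc, p.getVert i.succ) := by
    obtain ⟨-, h | ⟨e, he, h⟩⟩ := p.adj_getVert_succ i.isLt
    · exact h
    · exact ⟨e, he, h.trans Sym2.eq_swap⟩
  choose g hgS hg using hadj
  refine ⟨p.length, fun i => p.getVert i, g, fun i j hij => ?_, fun i => ⟨hgS i, hg i⟩,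
    p.getVert_zero, p.getVert_length⟩
  exact Fin.ext (hp.getVert_injOn i.is_le j.is_le hij)

theorem injective_of_ends_eq_castSucc_succ {n : ℕ} {v : Fin (n + 1) → G.V} {g : Fin n → G.E}
    (hv : Function.Injective v) (hg : ∀ i, G.ends (g i) = s(v i.castSucc, v i.succ)) :
    Function.Injective g := by
  intro i j hij
  have hends := hg i
  rw [hij, hg j, Sym2.eq_iff] at hends
  rcases hends with ⟨h, -⟩ | ⟨h, h'⟩
  · exact (Fin.castSucc_injective n (hv h)).symm
  · have h := congrArg Fin.val (hv h)
    have h' := congrArg Fin.val (hv h')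
    simp only [Fin.val_castSucc, Fin.val_succ] at h h'
    omega

theorem exists_isCircle_of_isDiag_map_part (heS : e ∉ S)
    (he : ((G.ends e).map (G.part S)).IsDiag) :
    ∃ C, G.IsCircle C ∧ e ∈ C ∧ C ⊆ insert e S := by
  obtain ⟨x, y, hxy⟩ := exists_ends e
  rw [hxy, Sym2.map_mk, Sym2.mk_isDiag_iff] at he
  obtain ⟨n, v, g, hv, hg, rfl, rfl⟩ := exists_path_of_part_eq he
  have hginj := injective_of_ends_eq_castSucc_succ hv fun i => (hg i).2
  have heg (i : Fin n) : g i ≠ e := fun h => heS (h ▸ (hg i).1)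
  refine ⟨Set.range (Fin.snoc (α := fun _ => G.E) g e), ⟨n, v, _, hv, ?_, ?_, rfl⟩,
    ⟨Fin.last n, Fin.snoc_last ..⟩, ?_⟩
  · exact Fin.snoc_injective_of_injective hginj (by rintro ⟨i, hi⟩; exact heg i hi)
  · refine Fin.lastCases ?_ fun i => ?_
    · rw [Fin.snoc_last, Fin.last_add_one, hxy, Sym2.eq_swap]
    · rw [Fin.snoc_castSucc, Fin.coeSucc_eq_succ, (hg i).2]
  · rw [Fin.range_snoc]
    exact Set.insert_subset_insert (Set.range_subset_iff.2 fun i => (hg i).1)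

theorem mem_clos_iff_isDiag : e ∈ G.clos S ↔ ((G.ends e).map (G.part S)).IsDiag := by
  constructor
  · rintro (he | ⟨C, hC, heC, hCS⟩)
    · exact isDiag_map_part_of_mem he
    · have hCS' : C \ {e} ⊆ S := fun f hf => (hCS hf.1).resolve_left hf.2
      have h := hC.isDiag_map_part_sdiff heC
      obtain ⟨a, b, hab⟩ := exists_ends e
      rw [hab, Sym2.map_mk, Sym2.mk_isDiag_iff] at h ⊢
      exact part_mono hCS' h
  · intro he
    by_cases heS : e ∈ S
    · exact Or.inl heS
    · exact Or.inr (exists_isCircle_of_isDiag_map_part heS he)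

theorem mem_clos_iff (h : G.ends e = s(a, b)) : e ∈ G.clos S ↔ G.part S a = G.part S b := by
  rw [mem_clos_iff_isDiag, h, Sym2.map_mk, Sym2.mk_isDiag_iff]

theorem subset_clos (S : Set G.E) : S ⊆ G.clos S := fun _ => Or.inl

theorem part_eq_of_subset_clos (hS : S' ⊆ G.clos S) (h : G.part S' a = G.part S' b) :
    G.part S a = G.part S b :=
  eq_of_part_eq (G.part S) (fun _ he => mem_clos_iff_isDiag.1 (hS he)) h

theorem clos_subset_clos (hS : S' ⊆ G.clos S) : G.clos S' ⊆ G.clos S := by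
  intro e he
  obtain ⟨a, b, hab⟩ := exists_ends e
  rw [mem_clos_iff hab] at he ⊢
  exact part_eq_of_subset_clos hS he

theorem part_union_eq_iff (hS : S' ⊆ G.clos S) :
    G.part (S ∪ S') a = G.part (S ∪ S') b ↔ G.part S a = G.part S b :=
  ⟨part_eq_of_subset_clos (Set.union_subset (subset_clos S) hS), part_mono Set.subset_union_left⟩

theorem IsLoop.mem_clos (he : G.IsLoop e) (S : Set G.E) : e ∈ G.clos S := by
  obtain ⟨a, b, hab⟩ := exists_ends e
  rw [IsLoop, hab, Sym2.mk_isDiag_iff] at he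
  rw [mem_clos_iff hab, he]

theorem part_empty_injective : Function.Injective (G.part ∅) := fun _ _ h =>
  eq_of_part_eq id (fun _ he => he.elim) h

end Closure

section Cardinality

variable {S S' F : Set G.E} {f : G.E} {a b p q : G.V}

theorem card_part_empty : Fintype.card (G.Part ∅) = Fintype.card G.V :=
  (Fintype.card_of_bijective ⟨part_empty_injective, part_surjective _⟩).symm

theorem card_part_le_of_subset_clos (hS : S' ⊆ G.clos S) :
    Fintype.card (G.Part S) ≤ Fintype.card (G.Part S') := by
  refine Fintype.card_le_of_surjective
    (Quot.lift (G.part S) fun a b h => part_eq_of_subset_clos hS (Quot.sound h)) fun B => ?_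
  obtain ⟨a, rfl⟩ := part_surjective S B
  exact ⟨G.part S' a, rfl⟩

open Classical in
-- Redirecting the class of `q` to the class of `p` gives a labelling constant on `insert f S`.
theorem redirected_part_eq_of_part_insert_eq (hf : G.ends f = s(p, q))
    (h : G.part (insert f S) a = G.part (insert f S) b) :
    (if G.part S a = G.part S q then G.part S p else G.part S a) =
      (if G.part S b = G.part S q then G.part S p else G.part S b) := by
  refine eq_of_part_eq
    (fun a => if G.part S a = G.part S q then G.part S p else G.part S a) ?_ h
  rintro e (rfl | he)
  · rw [hf, Sym2.map_mk, Sym2.mk_isDiag_iff, if_pos rfl, ite_self]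
  · obtain ⟨c, d, hcd⟩ := exists_ends e
    rw [hcd, Sym2.map_mk, Sym2.mk_isDiag_iff, (mem_clos_iff hcd).1 (subset_clos S he)]

theorem nonempty_equiv_part_insert (hf : G.ends f = s(p, q)) (hpq : G.part S p ≠ G.part S q) :
    Nonempty ({B : G.Part S // B ≠ G.part S q} ≃ G.Part (insert f S)) := by
  have hmono {a b : G.V} : G.part S a = G.part S b → _ := part_mono (Set.subset_insert f S)
  have hinsert := (mem_clos_iff hf).1 (subset_clos _ (Set.mem_insert f S))
  have hsurj : Function.Surjective fun a : {a // G.part S a ≠ G.part S q} =>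
      (⟨G.part S a, a.2⟩ : {B : G.Part S // B ≠ G.part S q}) := by
    rintro ⟨B, hB⟩
    obtain ⟨a, rfl⟩ := part_surjective S B
    exact ⟨⟨a, hB⟩, rfl⟩
  have hsurj' : Function.Surjective fun a : {a // G.part S a ≠ G.part S q} =>
      G.part (insert f S) a := by
    intro B
    obtain ⟨a, rfl⟩ := part_surjective _ B
    by_cases ha : G.part S a = G.part S q
    · exact ⟨⟨p, hpq⟩, hinsert.trans (hmono ha).symm⟩
    · exact ⟨⟨a, ha⟩, rfl⟩
  obtain ⟨φ, -⟩ := exists_equiv_of_surjective hsurj hsurj' fun a b => by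
    rw [Subtype.mk.injEq]
    refine ⟨hmono, fun h => ?_⟩
    simpa only [if_neg a.2, if_neg b.2] using redirected_part_eq_of_part_insert_eq hf h
  exact ⟨φ⟩

theorem card_part_insert (hf : f ∉ G.clos S) :
    Fintype.card (G.Part (insert f S)) + 1 = Fintype.card (G.Part S) := by
  classical
  obtain ⟨p, q, hpq⟩ := exists_ends f
  rw [mem_clos_iff hpq] at hf
  obtain ⟨φ⟩ := nonempty_equiv_part_insert hpq hf
  rw [← Fintype.card_congr φ, Fintype.card_subtype_compl, Fintype.card_subtype_eq]
  exact Nat.sub_add_cancel (Fintype.card_pos_iff.2 ⟨G.part S p⟩)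

theorem card_le_card_add_card_part (S : Finset G.E) :
    Fintype.card G.V ≤ S.card + Fintype.card (G.Part (S : Set G.E)) := by
  classical
  induction S using Finset.induction_on with
  | empty => rw [Finset.coe_empty, card_part_empty, Finset.card_empty, zero_add]
  | insert e S he ih =>
    rw [Finset.coe_insert, Finset.card_insert_of_notMem he]
    by_cases h : e ∈ G.clos (S : Set G.E)
    · have := card_part_le_of_subset_clos (Set.insert_subset h (subset_clos (S : Set G.E)))
      omega
    · have := card_part_insert h
      omega

theorem IsForest.mono {F' : Set G.E} (hF : G.IsForest F) (h : F' ⊆ F) : G.IsForest F' :=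
  fun C hC => hF C (hC.trans h)

theorem IsForest.notMem_clos_sdiff (hF : G.IsForest F) (hf : f ∈ F) : f ∉ G.clos (F \ {f}) := by
  rintro (h | ⟨C, hC, -, hCF⟩)
  · exact h.2 rfl
  · rw [Set.insert_sdiff_singleton, Set.insert_eq_of_mem hf] at hCF
    exact hF C hCF hC

theorem IsForest.card_add_card_part {F : Finset G.E} (hF : G.IsForest F) :
    F.card + Fintype.card (G.Part (F : Set G.E)) = Fintype.card G.V := by
  classical
  induction F using Finset.induction_on with
  | empty => rw [Finset.coe_empty, card_part_empty, Finset.card_empty, zero_add]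
  | insert e F he ih =>
    have hins := hF.notMem_clos_sdiff (Finset.mem_coe.2 (Finset.mem_insert_self e F))
    rw [Finset.coe_insert, Set.insert_sdiff_self_of_notMem (Finset.mem_coe.not.2 he)] at hins
    rw [Finset.coe_insert] at hF ⊢
    rw [Finset.card_insert_of_notMem he, ← ih (hF.mono (Set.subset_insert e _)),
      ← card_part_insert hins]
    omega

theorem isForest_iff_card {F : Finset G.E} :
    G.IsForest F ↔ F.card + Fintype.card (G.Part (F : Set G.E)) = Fintype.card G.V := by
  classical
  refine ⟨IsForest.card_add_card_part, fun h C hCF hC => ?_⟩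
  obtain ⟨f, hfC⟩ := hC.nonempty
  have hfF : f ∈ F := hCF hfC
  have hf : f ∈ G.clos (F.erase f : Finset G.E) := by
    refine Or.inr ⟨C, hC, hfC, ?_⟩
    rwa [← Finset.coe_insert, Finset.insert_erase hfF]
  have hF : (F : Set G.E) ⊆ G.clos (F.erase f : Finset G.E) := by
    nth_rw 1 [← Finset.insert_erase hfF]
    rw [Finset.coe_insert]
    exact Set.insert_subset hf (subset_clos _)
  have hle := card_part_le_of_subset_clos hF
  have hge := card_le_card_add_card_part (F.erase f)
  have := Finset.card_erase_add_one hfF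
  omega

theorem isForest_empty : G.IsForest ∅ := fun _ hC hcirc =>
  hcirc.nonempty.ne_empty (Set.subset_eq_empty hC rfl)

theorem IsLink.isForest_singleton (he : G.IsLink f) : G.IsForest {f} := by
  have hnot : f ∉ G.clos ∅ := by
    obtain ⟨a, b, hab⟩ := exists_ends f
    rw [mem_clos_iff hab, part_empty_injective.eq_iff]
    rwa [IsLink, hab, Sym2.mk_isDiag_iff] at he
  have hcard := card_part_insert hnot
  rw [card_part_empty, insert_empty_eq] at hcard
  rw [← Finset.coe_singleton, isForest_iff_card, Finset.coe_singleton, Finset.card_singleton,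
    add_comm, hcard]

theorem card_edges_delete_lt (e : G.E) : Nat.card (G.delete {e}).E < Nat.card G.E :=
  haveI := G.finE
  Finite.card_subtype_lt (x := e) (not_not_intro (Set.mem_singleton e))

end Cardinality

variable [AddCommSemigroup W] {H : WeightedGraph.{u} W}

section Terms

/-- The monomial `∏_{B ∈ π(S)} u_{h(B)}`. -/
noncomputable def partMonomial (G : WeightedGraph.{u} W) (S : Set G.E) : DPoly W :=
  ∏ B : G.Part S, uVar (G.blockWeight S B)

/-- The summand of the edge set `S` in the subset expansion defining `dichromatic`. -/
noncomputable def dichromaticTerm (G : WeightedGraph.{u} W) (S : Finset G.E) : DPoly W :=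
  vVar ^ (S.card + Fintype.card (G.Part (S : Set G.E)) - Fintype.card G.V) * G.partMonomial S

theorem dichromatic_eq_sum (G : WeightedGraph.{u} W) :
    G.dichromatic = ∑ S, G.dichromaticTerm S := rfl

open Classical in
theorem coe_blockWeight (S : Set G.E) (B : G.Part S) :
    (G.blockWeight S B : WithZero W) = ∑ a with G.part S a = B, (G.h a : WithZero W) :=
  coe_semigroupSum _ _ _

open Classical in
/-- A surjection of vertex sets that sums the weights over its fibres. -/
structure IsMerging (p : G.V → H.V) : Prop where
  surjective : Function.Surjective p
  coe_h : ∀ b, (H.h b : WithZero W) = ∑ a with p a = b, (G.h a : WithZero W)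

theorem isMerging_equiv (p : G.V ≃ H.V) (h : ∀ a, H.h (p a) = G.h a) : IsMerging p where
  surjective := p.surjective
  coe_h b := by
    obtain ⟨a, rfl⟩ := p.surjective b
    rw [h, Finset.sum_filter, Fintype.sum_eq_single a fun c hc => if_neg (p.injective.ne hc),
      if_pos rfl]

theorem isMerging_id : IsMerging (id : G.V → G.V) := isMerging_equiv (Equiv.refl G.V) fun _ => rfl

namespace IsMerging

variable {p : G.V → H.V} {S : Set G.E} {S' : Set H.E}

theorem blockWeight_eq (hp : IsMerging p)
    (hS : ∀ a b, G.part S a = G.part S b ↔ H.part S' (p a) = H.part S' (p b)) (a : G.V) :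
    G.blockWeight S (G.part S a) = H.blockWeight S' (H.part S' (p a)) := by
  classical
  apply WithZero.coe_injective
  have hfiber := Finset.sum_fiberwise_eq_sum_filter Finset.univ
    {b | H.part S' b = H.part S' (p a)} p fun c => (G.h c : WithZero W)
  simp only [Finset.mem_filter_univ] at hfiber
  simp only [coe_blockWeight, hp.coe_h, hS]
  convert hfiber.symm

theorem exists_equiv_part (hp : IsMerging p)
    (hS : ∀ a b, G.part S a = G.part S b ↔ H.part S' (p a) = H.part S' (p b)) :
    ∃ φ : G.Part S ≃ H.Part S', ∀ B, G.blockWeight S B = H.blockWeight S' (φ B) := by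
  obtain ⟨φ, hφ⟩ := exists_equiv_of_surjective (part_surjective S)
    ((part_surjective S').comp hp.surjective) hS
  refine ⟨φ, fun B => ?_⟩
  obtain ⟨a, rfl⟩ := part_surjective S B
  rw [hφ, hp.blockWeight_eq hS, Function.comp_apply]

theorem card_part_eq (hp : IsMerging p)
    (hS : ∀ a b, G.part S a = G.part S b ↔ H.part S' (p a) = H.part S' (p b)) :
    Fintype.card (G.Part S) = Fintype.card (H.Part S') := by
  obtain ⟨φ, -⟩ := hp.exists_equiv_part hS
  exact Fintype.card_congr φ

theorem partMonomial_eq (hp : IsMerging p)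
    (hS : ∀ a b, G.part S a = G.part S b ↔ H.part S' (p a) = H.part S' (p b)) :
    G.partMonomial S = H.partMonomial S' := by
  obtain ⟨φ, hφ⟩ := hp.exists_equiv_part hS
  exact Fintype.prod_equiv φ _ _ fun B => congrArg uVar (hφ B)

end IsMerging

theorem partMonomial_union_of_subset_clos {S A : Set G.E} (hA : A ⊆ G.clos S) :
    G.partMonomial (S ∪ A) = G.partMonomial S :=
  isMerging_id.partMonomial_eq fun _ _ => part_union_eq_iff hA

theorem dichromaticTerm_union_of_subset_clos [DecidableEq G.E] {S A : Finset G.E}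
    (hSA : Disjoint S A) (hA : (A : Set G.E) ⊆ G.clos S) :
    G.dichromaticTerm (S ∪ A) = vVar ^ A.card * G.dichromaticTerm S := by
  have hcard := isMerging_id.card_part_eq fun _ _ => part_union_eq_iff hA
  have hle := card_le_card_add_card_part S
  rw [dichromaticTerm, dichromaticTerm, Finset.coe_union, partMonomial_union_of_subset_clos hA,
    hcard, Finset.card_union_of_disjoint hSA, ← mul_assoc, ← pow_add]
  congr 2
  omega

theorem IsForest.dichromaticTerm_eq {F : Finset G.E} (hF : G.IsForest F) :
    G.dichromaticTerm F = G.partMonomial F := by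
  rw [dichromaticTerm, hF.card_add_card_part, Nat.sub_self, pow_zero, one_mul]

end Terms

section Minors

/-- `H` presented as the minor of `G` in which the components of `X` are contracted and all edges
outside of `X` and the range of `edge` are deleted. -/
structure MinorMap (G H : WeightedGraph.{u} W) (X : Set G.E) where
  vert : G.V → H.V
  edge : H.E ↪ G.E
  isMerging : IsMerging vert
  vert_eq_iff : ∀ a b, vert a = vert b ↔ G.part X a = G.part X b
  ends_edge : ∀ e, H.ends e = (G.ends (edge e)).map vert
  edge_notMem : ∀ e, edge e ∉ X

/-- Isomorphic graphs as minors of each other, without contracted edges. -/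
def Iso.minorMap (φ : Iso G H) : MinorMap G H ∅ where
  vert := φ.vert
  edge := φ.edge.symm.toEmbedding
  isMerging := isMerging_equiv φ.vert φ.h_vert
  vert_eq_iff _ _ := φ.vert.injective.eq_iff.trans part_empty_injective.eq_iff.symm
  ends_edge e := by
    rw [Equiv.coe_toEmbedding, ← φ.ends_edge, Equiv.apply_symm_apply]
  edge_notMem _ := id

/-- A deletion as a minor. -/
def deleteMinorMap (G : WeightedGraph.{u} W) (Y : Set G.E) : MinorMap G (G.delete Y) ∅ where
  vert := id
  edge := Function.Embedding.subtype _
  isMerging := ⟨Function.surjective_id, (isMerging_id (G := G)).coe_h⟩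
  vert_eq_iff _ _ := part_empty_injective.eq_iff.symm
  ends_edge e := (congrFun Sym2.map_id (G.ends e.1)).symm
  edge_notMem _ := id

/-- A contraction as a minor. -/
noncomputable def contractMinorMap (G : WeightedGraph.{u} W) (X : Set G.E) :
    MinorMap G (G.contract X) X where
  vert := G.part X
  edge := Function.Embedding.subtype _
  isMerging := ⟨part_surjective X, coe_blockWeight X⟩
  vert_eq_iff _ _ := Iff.rfl
  ends_edge _ := rfl
  edge_notMem e := e.2

namespace MinorMap

variable {X : Set G.E}

theorem part_eq_iff (m : MinorMap G H X) (S : Set H.E) (a b : G.V) :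
    G.part (X ∪ m.edge '' S) a = G.part (X ∪ m.edge '' S) b ↔
      H.part S (m.vert a) = H.part S (m.vert b) := by
  constructor
  · refine eq_of_part_eq (fun a => H.part S (m.vert a)) ?_
    rintro _ (he | ⟨e, he, rfl⟩)
    · obtain ⟨c, d, hcd⟩ := exists_ends _
      rw [hcd, Sym2.map_mk, Sym2.mk_isDiag_iff,
        (m.vert_eq_iff c d).2 ((mem_clos_iff hcd).1 (subset_clos X he))]
    · have hdiag := isDiag_map_part_of_mem he
      rwa [m.ends_edge, Sym2.map_map] at hdiag
  · intro h
    have hsurj := m.isMerging.surjective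
    have hsection (a : G.V) : G.part (X ∪ m.edge '' S) (Function.surjInv hsurj (m.vert a)) =
        G.part (X ∪ m.edge '' S) a :=
      part_mono Set.subset_union_left ((m.vert_eq_iff _ _).1 (Function.surjInv_eq hsurj _))
    rw [← hsection a, ← hsection b]
    refine eq_of_part_eq (fun c => G.part (X ∪ m.edge '' S) (Function.surjInv hsurj c))
      (fun e he => ?_) h
    rw [m.ends_edge, Sym2.map_map]
    simpa only [Function.comp_def, hsection] using
      isDiag_map_part_of_mem (Set.mem_union_right X (Set.mem_image_of_mem m.edge he))

theorem card_add_card [Fintype X] (m : MinorMap G H X) (hX : G.IsForest X) :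
    X.toFinset.card + Fintype.card H.V = Fintype.card G.V := by
  obtain ⟨φ, -⟩ := exists_equiv_of_surjective m.isMerging.surjective (part_surjective X)
    m.vert_eq_iff
  rw [← X.coe_toFinset] at hX
  have hcard := hX.card_add_card_part
  rwa [X.coe_toFinset, ← Fintype.card_congr φ] at hcard

theorem dichromaticTerm_union [DecidableEq G.E] [Fintype X] (m : MinorMap G H X)
    (hX : G.IsForest X) (S : Finset H.E) :
    G.dichromaticTerm (X.toFinset ∪ S.map m.edge) = H.dichromaticTerm S := by
  have hdisj : Disjoint X.toFinset (S.map m.edge) := by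
    rw [Finset.disjoint_right]
    intro _ he
    obtain ⟨e, -, rfl⟩ := Finset.mem_map.1 he
    exact Set.mem_toFinset.not.2 (m.edge_notMem e)
  have hcard := m.card_add_card hX
  rw [dichromaticTerm, dichromaticTerm, Finset.card_union_of_disjoint hdisj, Finset.card_map,
    Finset.coe_union, Finset.coe_map, X.coe_toFinset, m.isMerging.card_part_eq (m.part_eq_iff _),
    m.isMerging.partMonomial_eq (m.part_eq_iff _)]
  congr 2
  omega

theorem dichromaticTerm_map (m : MinorMap G H ∅) (S : Finset H.E) :
    G.dichromaticTerm (S.map m.edge) = H.dichromaticTerm S := by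
  classical
  rw [← m.dichromaticTerm_union isForest_empty S, Set.toFinset_empty, Finset.empty_union]

end MinorMap

end Minors

section DeletionContraction

variable {e : G.E}

theorem range_deleteMinorMap_edge (Y : Set G.E) : Set.range (G.deleteMinorMap Y).edge = Yᶜ :=
  Subtype.range_val

theorem notMem_map_deleteMinorMap_edge (S : Finset (G.delete {e}).E) :
    e ∉ S.map (G.deleteMinorMap {e}).edge := fun h => by
  obtain ⟨f, -, hf⟩ := Finset.mem_map.1 h
  exact f.2 hf

theorem dichromatic_of_isLink (he : G.IsLink e) :
    G.dichromatic = (G.delete {e}).dichromatic + (G.contract {e}).dichromatic := by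
  classical
  have hdelete : (G.delete {e}).dichromatic =
      ∑ S : Finset (G.delete {e}).E, G.dichromaticTerm (S.map (G.deleteMinorMap {e}).edge) :=
    Finset.sum_congr rfl fun S _ => ((G.deleteMinorMap {e}).dichromaticTerm_map S).symm
  have hcontract : (G.contract {e}).dichromatic =
      ∑ S : Finset (G.contract {e}).E,
        G.dichromaticTerm (insert e (S.map (G.contractMinorMap {e}).edge)) := by
    refine Finset.sum_congr rfl fun S _ => ?_
    rw [Finset.insert_eq, ← Set.toFinset_singleton,
      (G.contractMinorMap {e}).dichromaticTerm_union he.isForest_singleton]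
    rfl
  rw [hdelete, hcontract]
  exact sum_finset_eq_sum_map_add_sum_insert (range_deleteMinorMap_edge {e}) G.dichromaticTerm

theorem dichromatic_of_isLoop (he : G.IsLoop e) :
    G.dichromatic = (vVar + 1) * (G.delete {e}).dichromatic := by
  classical
  have hterm (S : Finset (G.delete {e}).E) :
      G.dichromaticTerm (insert e (S.map (G.deleteMinorMap {e}).edge)) =
        vVar * (G.delete {e}).dichromaticTerm S := by
    have hmem : (({e} : Finset G.E) : Set G.E) ⊆ G.clos (S.map (G.deleteMinorMap {e}).edge) := by
      rw [Finset.coe_singleton, Set.singleton_subset_iff]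
      exact he.mem_clos _
    rw [Finset.insert_eq, Finset.union_comm, dichromaticTerm_union_of_subset_clos
      (Finset.disjoint_singleton_right.2 (notMem_map_deleteMinorMap_edge S)) hmem,
      Finset.card_singleton, pow_one, MinorMap.dichromaticTerm_map]
  rw [dichromatic_eq_sum, sum_finset_eq_sum_map_add_sum_insert (range_deleteMinorMap_edge {e})]
  simp only [hterm, MinorMap.dichromaticTerm_map]
  rw [← Finset.mul_sum, ← dichromatic_eq_sum, add_mul, one_mul, add_comm]

theorem dichromatic_congr (φ : Iso G H) : G.dichromatic = H.dichromatic :=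
  Fintype.sum_equiv φ.edge.finsetCongr _ _ fun S => by
    have hmap : (φ.edge.finsetCongr S).map φ.minorMap.edge = S := by
      ext e
      simp [Iso.minorMap]
    exact (congrArg G.dichromaticTerm hmap).symm.trans (φ.minorMap.dichromaticTerm_map _)

theorem blockWeight_empty (a : G.V) : G.blockWeight ∅ (G.part ∅ a) = G.h a := by
  classical
  apply WithZero.coe_injective
  rw [coe_blockWeight]
  simp only [part_empty_injective.eq_iff]
  exact (isMerging_id.coe_h a).symm

theorem dichromatic_of_isEmpty_edges [IsEmpty G.E] : G.dichromatic = ∏ a, uVar (G.h a) := by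
  have hprod : ∏ a, uVar (G.h a) = G.partMonomial ∅ :=
    Fintype.prod_bijective (G.part ∅) ⟨part_empty_injective, part_surjective _⟩ _ _ fun a => by
      rw [blockWeight_empty]
  have hforest : G.IsForest (∅ : Finset G.E) := Finset.coe_empty (α := G.E) ▸ isForest_empty
  rw [dichromatic_eq_sum, Fintype.sum_subsingleton _ ∅, hforest.dichromaticTerm_eq, hprod,
    Finset.coe_empty]

theorem tutteConditions_dichromatic :
    TutteConditions (fun G : WeightedGraph.{u} W => G.dichromatic) uVar vVar where
  additivity _ _ he := dichromatic_of_isLink he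
  invariance _ _ h := h.elim dichromatic_congr
  unitarity G hV := by
    have hE : IsEmpty G.E := ⟨fun e => hV.false (exists_ends e).choose⟩
    rw [dichromatic_of_isEmpty_edges, Finset.univ_eq_empty, Finset.prod_empty]
  initial _ _ := dichromatic_of_isEmpty_edges
  loop _ _ he := dichromatic_of_isLoop he

end DeletionContraction

section Universality

variable {R : Type r} [CommRing R] {f g : WeightedGraph.{u} W → R} {x : W → R} {y : R}

theorem TutteConditions.ext (hf : TutteConditions f x y) (hg : TutteConditions g x y)
    (G : WeightedGraph.{u} W) : f G = g G := by
  induction hn : Nat.card G.E using Nat.strong_induction_on generalizing G with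
  | _ n ih =>
    subst hn
    cases isEmpty_or_nonempty G.E with
    | inl hE => rw [hf.initial G hE, hg.initial G hE]
    | inr hE =>
      obtain ⟨e⟩ := hE
      have hlt := card_edges_delete_lt e
      by_cases he : G.IsLoop e
      · rw [hf.loop G e he, hg.loop G e he, ih _ hlt _ rfl]
      · rw [hf.additivity G e he, hg.additivity G e he, ih _ hlt _ rfl,
          ih (Nat.card (G.contract {e}).E) hlt _ rfl]

theorem TutteConditions.map {R' : Type*} [CommRing R'] (hf : TutteConditions f x y)
    (ψ : R →+* R') : TutteConditions (fun G => ψ (f G)) (fun k => ψ (x k)) (ψ y) where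
  additivity G e he := by rw [hf.additivity G e he, map_add]
  invariance G H h := by rw [hf.invariance G H h]
  unitarity G h := by rw [hf.unitarity G h, map_one]
  initial G h := by rw [hf.initial G h, map_prod]
  loop G e he := by rw [hf.loop G e he, map_mul, map_add, map_one]

theorem tutteConditions_subst (x : W → R) (y : R) :
    TutteConditions (fun G : WeightedGraph.{u} W => subst x y G.dichromatic) x y := by
  simpa [subst, uVar, vVar] using tutteConditions_dichromatic.map (subst x y)

theorem tutteConditions_iff (f : WeightedGraph.{u} W → R) (x : W → R) (y : R) :
    TutteConditions f x y ↔ ∀ G, f G = subst x y G.dichromatic :=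
  ⟨fun hf => hf.ext (tutteConditions_subst x y),
    fun h => funext h ▸ tutteConditions_subst x y⟩

end Universality

end WeightedGraph

namespace WeightedGraph

section DisjointUnion

variable {W : Type w} {ι : Type u} {G : WeightedGraph.{u} W} {H : ι → WeightedGraph.{u} W}

/-- `G` presented as the disjoint union of the weighted graphs `H i`. -/
structure DisjointUnion (G : WeightedGraph.{u} W) (H : ι → WeightedGraph.{u} W) where
  vert : (Σ i, (H i).V) ≃ G.V
  edge : (Σ i, (H i).E) ≃ G.E
  ends_edge : ∀ i e, G.ends (edge ⟨i, e⟩) = ((H i).ends e).map fun a => vert ⟨i, a⟩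
  h_vert : ∀ i a, G.h (vert ⟨i, a⟩) = (H i).h a

namespace DisjointUnion

/-- The class of a vertex of a disjoint union with respect to an edge set, in terms of the traces
`S i` of the edge set on the summands. -/
def sigmaPart (S : ∀ i, Set (H i).E) : (Σ i, (H i).V) → Σ i, (H i).Part (S i) :=
  Sigma.map id fun i => (H i).part (S i)

theorem part_eq_iff (d : DisjointUnion G H) (S : ∀ i, Set (H i).E) (a b : Σ i, (H i).V) :
    G.part (d.edge '' Set.univ.sigma S) (d.vert a) =
        G.part (d.edge '' Set.univ.sigma S) (d.vert b) ↔
      sigmaPart S a = sigmaPart S b := by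
  constructor
  · intro h
    have hpart := eq_of_part_eq (fun c => sigmaPart S (d.vert.symm c)) ?_ h
    · simpa only [Equiv.symm_apply_apply] using hpart
    rintro _ ⟨⟨i, e⟩, ⟨-, he⟩, rfl⟩
    have hdiag := (isDiag_map_part_of_mem he).map (f := Sigma.mk (β := fun i => (H i).Part (S i)) i)
    rw [Sym2.map_map] at hdiag
    simp only [d.ends_edge, Sym2.map_map, Function.comp_def, Equiv.symm_apply_apply]
    exact hdiag
  · obtain ⟨i, a⟩ := a
    obtain ⟨j, b⟩ := b
    intro h
    obtain ⟨rfl, h⟩ := Sigma.mk.inj_iff.1 h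
    refine eq_of_part_eq (fun c => G.part _ (d.vert ⟨i, c⟩)) (fun e he => ?_) (eq_of_heq h)
    have hdiag := isDiag_map_part_of_mem (Set.mem_image_of_mem d.edge
      (show ⟨i, e⟩ ∈ Set.univ.sigma S from ⟨Set.mem_univ i, he⟩))
    rwa [d.ends_edge, Sym2.map_map] at hdiag

theorem exists_part_equiv (d : DisjointUnion G H) (S : ∀ i, Set (H i).E) :
    ∃ φ : G.Part (d.edge '' Set.univ.sigma S) ≃ Σ i, (H i).Part (S i),
      ∀ a, φ (G.part _ (d.vert a)) = sigmaPart S a :=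
  exists_equiv_of_surjective ((part_surjective _).comp d.vert.surjective)
    (Function.surjective_id.sigma_map fun i => part_surjective (S i)) (d.part_eq_iff S)

theorem card_part [Fintype ι] (d : DisjointUnion G H) (S : ∀ i, Set (H i).E) :
    Fintype.card (G.Part (d.edge '' Set.univ.sigma S)) =
      ∑ i, Fintype.card ((H i).Part (S i)) := by
  obtain ⟨φ, -⟩ := d.exists_part_equiv S
  rw [Fintype.card_congr φ, Fintype.card_sigma]

theorem card_vert [Fintype ι] (d : DisjointUnion G H) :
    Fintype.card G.V = ∑ i, Fintype.card (H i).V := by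
  rw [← Fintype.card_congr d.vert, Fintype.card_sigma]

variable [AddCommSemigroup W]

theorem blockWeight_eq (d : DisjointUnion G H) (S : ∀ i, Set (H i).E) (i : ι) (a : (H i).V) :
    G.blockWeight (d.edge '' Set.univ.sigma S) (G.part _ (d.vert ⟨i, a⟩)) =
      (H i).blockWeight (S i) ((H i).part (S i) a) := by
  classical
  have hblock : Finset.univ.filter (fun c => G.part (d.edge '' Set.univ.sigma S) c =
        G.part (d.edge '' Set.univ.sigma S) (d.vert ⟨i, a⟩)) =
      (Finset.univ.filter fun c => (H i).part (S i) c = (H i).part (S i) a).map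
        ((Function.Embedding.sigmaMk i).trans d.vert.toEmbedding) := by
    ext c
    obtain ⟨⟨j, c⟩, rfl⟩ := d.vert.surjective c
    rw [Finset.mem_filter_univ, d.part_eq_iff]
    constructor
    · intro h
      obtain ⟨rfl, h⟩ := Sigma.mk.inj_iff.1 h
      exact Finset.mem_map_of_mem _ ((Finset.mem_filter_univ _).2 (eq_of_heq h))
    · intro h
      obtain ⟨c', hc', h⟩ := Finset.mem_map.1 h
      obtain ⟨rfl, rfl⟩ := Sigma.mk.inj_iff.1 (d.vert.injective h)
      exact congrArg (Sigma.mk i) ((Finset.mem_filter_univ c').1 hc')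
  apply WithZero.coe_injective
  rw [coe_blockWeight, coe_blockWeight, hblock, Finset.sum_map]
  exact Finset.sum_congr rfl fun c _ => congrArg _ (d.h_vert i c)

theorem partMonomial_eq [Fintype ι] (d : DisjointUnion G H) (S : ∀ i, Set (H i).E) :
    G.partMonomial (d.edge '' Set.univ.sigma S) = ∏ i, (H i).partMonomial (S i) := by
  obtain ⟨φ, hφ⟩ := d.exists_part_equiv S
  simp only [partMonomial]
  rw [← Fintype.prod_sigma']
  refine Fintype.prod_equiv φ _ _ fun B => ?_
  obtain ⟨a, rfl⟩ := ((part_surjective _).comp d.vert.surjective) B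
  rw [Function.comp_apply, hφ, d.blockWeight_eq]
  rfl

theorem dichromaticTerm_eq [Fintype ι] (d : DisjointUnion G H) (S : ∀ i, Finset (H i).E) :
    G.dichromaticTerm ((Finset.univ.sigma S).map d.edge.toEmbedding) =
      ∏ i, (H i).dichromaticTerm (S i) := by
  simp only [dichromaticTerm]
  rw [Finset.prod_mul_distrib, Finset.prod_pow_eq_pow_sum, Finset.coe_map, Equiv.coe_toEmbedding,
    Finset.coe_sigma, Finset.coe_univ, d.partMonomial_eq, d.card_part, d.card_vert,
    Finset.card_map, Finset.card_sigma, ← Finset.sum_add_distrib,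
    Finset.sum_tsub_distrib _ fun i _ => card_le_card_add_card_part (S i)]

theorem dichromatic_eq [Fintype ι] (d : DisjointUnion G H) :
    G.dichromatic = ∏ i, (H i).dichromatic := by
  classical
  simp only [dichromatic_eq_sum]
  rw [Finset.prod_univ_sum, Fintype.piFinset_univ]
  symm
  refine Fintype.sum_bijective (fun S => (Finset.univ.sigma S).map d.edge.toEmbedding)
    ⟨fun S S' h => ?_, fun T => ?_⟩ _ _ fun S => (d.dichromaticTerm_eq S).symm
  · have h := Finset.map_injective _ h
    funext i
    ext e
    simpa using Finset.ext_iff.1 h ⟨i, e⟩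
  · refine ⟨fun i => {e | d.edge ⟨i, e⟩ ∈ T}, ?_⟩
    ext e
    obtain ⟨⟨i, e⟩, rfl⟩ := d.edge.surjective e
    simp

end DisjointUnion

theorem part_eq_of_mem_ends (G : WeightedGraph.{u} W) {e : G.E} {a b : G.V} (ha : a ∈ G.ends e)
    (hb : b ∈ G.ends e) : G.part Set.univ a = G.part Set.univ b := by
  obtain ⟨c, d, hcd⟩ := exists_ends e
  have hdiag := isDiag_map_part_of_mem (Set.mem_univ e)
  rw [hcd, Sym2.map_mk, Sym2.mk_isDiag_iff] at hdiag
  rw [hcd, Sym2.mem_iff] at ha hb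
  rcases ha with rfl | rfl <;> rcases hb with rfl | rfl <;> simp only [hdiag]

/-- A weighted graph as the disjoint union of its connected components. -/
noncomputable def componentDisjointUnion (G : WeightedGraph.{u} W) :
    DisjointUnion G G.component where
  vert := Equiv.sigmaFiberEquiv (G.part Set.univ)
  edge := Equiv.ofBijective (fun e => e.2.1) (by
    constructor
    · rintro ⟨B, e, he⟩ ⟨C, e', hC⟩ (rfl : e = e')
      obtain ⟨a, b, hab⟩ := exists_ends e
      have ha : a ∈ G.ends e := hab ▸ Sym2.mem_mk_left a b
      obtain rfl : B = C := (he a ha).symm.trans (hC a ha)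
      rfl
    · intro e
      obtain ⟨a, b, hab⟩ := exists_ends e
      have ha : a ∈ G.ends e := hab ▸ Sym2.mem_mk_left a b
      exact ⟨⟨G.part Set.univ a, e, fun c hc => G.part_eq_of_mem_ends hc ha⟩, rfl⟩)
  ends_edge _ _ := (Sym2.attachWith_map_subtypeVal _).symm
  h_vert _ _ := rfl

variable [AddCommSemigroup W]

theorem dichromatic_eq_prod_component (G : WeightedGraph.{u} W) :
    G.dichromatic = ∏ B, (G.component B).dichromatic :=
  G.componentDisjointUnion.dichromatic_eq

end DisjointUnion

end WeightedGraph

theorem sum_Icc_union {α M : Type*} [DecidableEq α] [AddCommMonoid M] {L T A : Finset α}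
    (hLT : L ⊆ T) (hTA : Disjoint T A) (g : Finset α → M) :
    ∑ S ∈ Finset.Icc L (T ∪ A), g S = ∑ F ∈ Finset.Icc L T, ∑ B ∈ A.powerset, g (F ∪ B) := by
  rw [← Finset.sum_product']
  symm
  refine Finset.sum_bij' (fun p _ => p.1 ∪ p.2) (fun S _ => (S ∩ T, S ∩ A)) ?_ ?_ ?_ ?_
    fun _ _ => rfl
  all_goals simp only [Finset.mem_product, Finset.mem_Icc, Finset.mem_powerset]
  · rintro ⟨F, B⟩ ⟨⟨hLF, hFT⟩, hBA⟩
    exact ⟨hLF.trans Finset.subset_union_left, Finset.union_subset_union hFT hBA⟩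
  · rintro S ⟨hLS, -⟩
    exact ⟨⟨Finset.subset_inter hLS hLT, Finset.inter_subset_right⟩, Finset.inter_subset_right⟩
  · rintro ⟨F, B⟩ ⟨⟨-, hFT⟩, hBA⟩
    have hBT : B ∩ T = ∅ := Finset.disjoint_iff_inter_eq_empty.1 (hTA.symm.mono_left hBA)
    have hFA : F ∩ A = ∅ := Finset.disjoint_iff_inter_eq_empty.1 (hTA.mono_left hFT)
    simp only [Finset.union_inter_distrib_right, Finset.inter_eq_left.2 hFT,
      Finset.inter_eq_left.2 hBA, hBT, hFA, Finset.union_empty, Finset.empty_union]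
  · rintro S ⟨-, hSTA⟩
    rw [← Finset.inter_union_distrib_left, Finset.inter_eq_left.2 hSTA]

namespace WeightedGraph

section GraphicMatroid

variable {W : Type w} {G : WeightedGraph.{u} W} {S T F : Set G.E} {e : G.E}

theorem IsForest.insert_of_notMem_clos (hF : G.IsForest F) (he : e ∉ G.clos F) :
    G.IsForest (insert e F) := by
  intro C hCF hC
  have heC : e ∉ C := fun heC => he (Or.inr ⟨C, hC, heC, hCF⟩)
  exact hF C (fun f hf => (hCF hf).resolve_left (ne_of_mem_of_not_mem hf heC)) hC

theorem IsForest.exists_insert {F' : Set G.E} (hF : G.IsForest F) (hF' : G.IsForest F')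
    (hcard : F.ncard < F'.ncard) : ∃ e ∈ F', e ∉ F ∧ G.IsForest (insert e F) := by
  by_contra! hmax
  have hclos : F' ⊆ G.clos F := fun e he =>
    by_contra fun heF => hmax e he (fun h => heF (subset_clos F h)) (hF.insert_of_notMem_clos heF)
  have hpart := card_part_le_of_subset_clos hclos
  lift F to Finset G.E using F.toFinite
  lift F' to Finset G.E using F'.toFinite
  rw [Set.ncard_coe_finset, Set.ncard_coe_finset] at hcard
  have hcardF := hF.card_add_card_part
  have hcardF' := hF'.card_add_card_part
  omega

/-- The graphic matroid, on the edges of `G`; its independent sets are the spanning forests. -/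
def graphicMatroid (G : WeightedGraph.{u} W) : Matroid G.E :=
  (IndepMatroid.ofFinite Set.finite_univ G.IsForest isForest_empty (fun _ _ hF => hF.mono)
    (fun _ _ => IsForest.exists_insert) fun _ _ => Set.subset_univ _).matroid

instance : G.graphicMatroid.Finite := ⟨Set.finite_univ⟩

theorem graphicMatroid_ground (G : WeightedGraph.{u} W) : G.graphicMatroid.E = Set.univ := rfl

theorem graphicMatroid_indep_iff : G.graphicMatroid.Indep F ↔ G.IsForest F := Iff.rfl

theorem graphicMatroid_isBase_iff : G.graphicMatroid.IsBase T ↔ G.IsSpanningTree T :=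
  Matroid.isBase_iff_maximal_indep

theorem IsForest.graphicMatroid_closure (hF : G.IsForest F) :
    G.graphicMatroid.closure F = G.clos F := by
  ext e
  rw [(graphicMatroid_indep_iff.2 hF).mem_closure_iff', graphicMatroid_indep_iff]
  refine ⟨fun h => by_contra fun he => he (subset_clos F (h.2 (hF.insert_of_notMem_clos he))),
    fun h => ⟨Set.mem_univ e, fun hins => by_contra fun heF => ?_⟩⟩
  have hnot := hins.notMem_clos_sdiff (Set.mem_insert e F)
  rw [Set.insert_sdiff_self_of_notMem heF] at hnot
  exact hnot h

theorem graphicMatroid_closure (S : Set G.E) : G.graphicMatroid.closure S = G.clos S := by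
  obtain ⟨F, hF⟩ := G.graphicMatroid.exists_isBasis S (Set.subset_univ S)
  have hFclos := (graphicMatroid_indep_iff.1 hF.indep).graphicMatroid_closure
  rw [← hF.closure_eq_closure, hFclos]
  refine (clos_subset_clos (hF.subset.trans (subset_clos S))).antisymm (clos_subset_clos ?_)
  exact hFclos ▸ hF.subset_closure

variable [LinearOrder G.E]

theorem extActive_eq_externallyActive (T : Set G.E) :
    G.extActive T = externallyActive G.graphicMatroid T := by
  ext e
  simp only [externallyActive, graphicMatroid_closure, graphicMatroid_ground]
  constructor
  · rintro ⟨heT, C, hC, hCT, heC, hmax⟩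
    refine ⟨⟨Set.mem_univ e, heT⟩, Or.inr ⟨C, hC, heC, fun f hf => ?_⟩⟩
    refine (hCT hf).imp_right fun hfT => ?_
    exact ⟨hfT, lt_of_le_of_ne (hmax hf) (ne_of_mem_of_not_mem hfT heT)⟩
  · rintro ⟨⟨-, heT⟩, he | ⟨C, hC, heC, hCT⟩⟩
    · exact absurd he.1 heT
    · refine ⟨heT, C, hC, fun f hf => (hCT hf).imp_right And.left, heC, fun f hf => ?_⟩
      exact (hCT hf).elim le_of_eq fun h => h.2.le

theorem IsSpanningTree.intActive_eq_internallyActive (hT : G.IsSpanningTree T) :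
    G.intActive T = internallyActive G.graphicMatroid T := by
  ext e
  have hbase := graphicMatroid_isBase_iff.2 hT
  rw [mem_internallyActive_iff hbase, ← hbase.closure_eq, graphicMatroid_closure,
    graphicMatroid_closure]
  rfl

theorem IsSpanningTree.activityInterval_graphicMatroid (hT : G.IsSpanningTree T) :
    activityInterval G.graphicMatroid T = Set.Icc (G.intInactive T) (T ∪ G.extActive T) := by
  rw [activityInterval, extActive_eq_externallyActive, ← hT.intActive_eq_internallyActive,
    intInactive]

theorem existsUnique_isSpanningTree (S : Set G.E) :
    ∃! T, G.IsSpanningTree T ∧ S ∈ Set.Icc (G.intInactive T) (T ∪ G.extActive T) := by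
  refine (existsUnique_congr fun T => ?_).1
    (existsUnique_isBase_mem_activityInterval (M := G.graphicMatroid) (Set.subset_univ S))
  rw [graphicMatroid_isBase_iff]
  exact and_congr_right fun hT => by rw [hT.activityInterval_graphicMatroid]

theorem IsSpanningTree.extActive_subset_clos_intInactive (hT : G.IsSpanningTree T) :
    G.extActive T ⊆ G.clos (G.intInactive T) := by
  intro e he
  rw [extActive_eq_externallyActive] at he
  rw [intInactive, hT.intActive_eq_internallyActive, ← graphicMatroid_closure]
  exact G.graphicMatroid.closure_subset_closure (Set.sep_subset _ _)
    (mem_closure_sdiff_internallyActive he)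

end GraphicMatroid

section TreeExpansion

variable {W : Type w} [AddCommSemigroup W] {G : WeightedGraph.{u} W} [LinearOrder G.E]

theorem IsSpanningTree.dichromaticTerm_union {T F A : Finset G.E} (hT : G.IsSpanningTree T)
    (hF : G.intInactive T ⊆ F) (hFT : F ⊆ T) (hA : (A : Set G.E) ⊆ G.extActive T) :
    G.dichromaticTerm (F ∪ A) = vVar ^ A.card * G.partMonomial F := by
  have hdisj : Disjoint F A :=
    Finset.disjoint_left.2 fun e heF heA => (hA heA).1 (hFT heF)
  have hclos := hT.extActive_subset_clos_intInactive.trans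
    (clos_subset_clos (hF.trans (subset_clos (F : Set G.E))))
  rw [dichromaticTerm_union_of_subset_clos hdisj (hA.trans hclos),
    (hT.prop.mono hFT : G.IsForest F).dichromaticTerm_eq]

open Classical in
theorem IsSpanningTree.sum_dichromaticTerm {T : Finset G.E} (hT : G.IsSpanningTree T) :
    ∑ S ∈ Finset.univ.filter (fun S : Finset G.E =>
        (S : Set G.E) ∈ Set.Icc (G.intInactive T) (T ∪ G.extActive T)), G.dichromaticTerm S =
      (vVar + 1) ^ (G.extActive T).ncard *
        ∑ F ∈ T.powerset.filter (fun F : Finset G.E => G.intInactive T ⊆ F),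
          G.partMonomial F := by
  obtain ⟨L, hL⟩ := (G.intInactive T).toFinite.exists_finset_coe
  obtain ⟨A, hA⟩ := (G.extActive T).toFinite.exists_finset_coe
  have hLT : L ⊆ T := Finset.coe_subset.1 (hL ▸ Set.sdiff_subset)
  have hTA : Disjoint T A :=
    Finset.disjoint_left.2 fun e heT heA => (hA.subset heA : e ∈ G.extActive T).1 heT
  have hinterval : Finset.univ.filter (fun S : Finset G.E =>
      (S : Set G.E) ∈ Set.Icc (G.intInactive T) (T ∪ G.extActive T)) = Finset.Icc L (T ∪ A) := by
    ext S
    rw [Finset.mem_filter_univ, ← hL, ← hA, ← Finset.coe_union, Set.mem_Icc, Finset.mem_Icc]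
    exact and_congr Finset.coe_subset Finset.coe_subset
  have hforests : T.powerset.filter (fun F : Finset G.E => G.intInactive T ⊆ F) =
      Finset.Icc L T := by
    ext F
    rw [Finset.mem_filter, Finset.mem_powerset, ← hL, Finset.coe_subset, Finset.mem_Icc, and_comm]
  rw [hinterval, hforests, sum_Icc_union hLT hTA, ← hA, Set.ncard_coe_finset, Finset.mul_sum]
  refine Finset.sum_congr rfl fun F hF => ?_
  obtain ⟨hLF, hFT⟩ := Finset.mem_Icc.1 hF
  calc ∑ B ∈ A.powerset, G.dichromaticTerm (F ∪ B)
      = ∑ B ∈ A.powerset, vVar ^ B.card * G.partMonomial F :=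
        Finset.sum_congr rfl fun B hB => hT.dichromaticTerm_union
          (hL ▸ Finset.coe_subset.2 hLF) hFT (hA ▸ Finset.coe_subset.2 (Finset.mem_powerset.1 hB))
    _ = (vVar + 1) ^ A.card * G.partMonomial F := by
        rw [← Finset.sum_mul, ← Finset.sum_pow_mul_eq_add_pow]
        simp only [one_pow, mul_one]

theorem dichromatic_eq_treeExpansion (G : WeightedGraph.{u} W) [LinearOrder G.E] :
    G.dichromatic = G.treeExpansion := by
  classical
  have hunique (S : Finset G.E) : ∃! T : Finset G.E, G.IsSpanningTree T ∧
      (S : Set G.E) ∈ Set.Icc (G.intInactive T) (T ∪ G.extActive T) := by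
    obtain ⟨T, hT, hTunique⟩ := existsUnique_isSpanningTree (S : Set G.E)
    lift T to Finset G.E using T.toFinite
    exact ⟨T, hT, fun T' hT' => Finset.coe_injective (hTunique _ hT')⟩
  choose tree htree htree_unique using hunique
  rw [dichromatic_eq_sum, ← Finset.sum_fiberwise_of_maps_to (g := tree)
    (t := Finset.univ.filter fun T : Finset G.E => G.IsSpanningTree T)
    fun S _ => (Finset.mem_filter_univ _).2 (htree S).1]
  refine Finset.sum_congr rfl fun T hT => ?_
  replace hT := (Finset.mem_filter_univ T).1 hT
  refine Eq.trans (Finset.sum_congr (Finset.filter_congr fun S _ => ?_) fun _ _ => rfl)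
    hT.sum_dichromaticTerm
  exact ⟨fun h => h ▸ (htree S).2, fun h => (htree_unique S T ⟨hT, h⟩).symm⟩

end TreeExpansion

end WeightedGraph

/-- The dichromatic polynomial satisfies deletion-contraction, isomorphism invariance, unitarity,
the initial condition and the loop identity.  It is universal with these properties: for all values
`x` and `y` of the variables in a commutative ring, a function has the properties if and only if it
is the evaluation of the dichromatic polynomial at these values.  It is multiplicative over
connected components, and it has the spanning-tree expansion for every linear ordering of the
edges. -/
theorem theoremT (W : Type w) [AddCommSemigroup W] :
    WeightedGraph.TutteConditions
      (fun G : WeightedGraph.{u} W => G.dichromatic) WeightedGraph.uVar WeightedGraph.vVar ∧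
    (∀ (R : Type r) [CommRing R] (f : WeightedGraph.{u} W → R) (x : W → R) (y : R),
      WeightedGraph.TutteConditions f x y ↔
        ∀ G : WeightedGraph.{u} W, f G = WeightedGraph.subst x y G.dichromatic) ∧
    (∀ G : WeightedGraph.{u} W,
      G.dichromatic = ∏ B : G.Part Set.univ, (G.component B).dichromatic) ∧
    (∀ (G : WeightedGraph.{u} W) [LinearOrder G.E], G.dichromatic = G.treeExpansion) :=
  ⟨WeightedGraph.tutteConditions_dichromatic, fun _ _ => WeightedGraph.tutteConditions_iff,
    WeightedGraph.dichromatic_eq_prod_component, WeightedGraph.dichromatic_eq_treeExpansion⟩
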